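/- Let $e_1=-1-3\sqrt2$, $H=\frac1{\sqrt2}\begin{pmatrix}1&1\\1&-1\end{pmatrix}$, $T=\mathrm{diag}(1,e^{i\pi/4})$ and $|\omega\rangle=\frac1{\sqrt8}\sum_{j=0}^7e^{-i\pi j/4}|j\rangle$. Put $$|\psi_{z,0}\rangle=\tfrac1{\sqrt8}\bigl(|z\rangle(|1\rangle+|3\rangle+|5\rangle+|7\rangle)+H|z\rangle(|2\rangle+|8\rangle)+HT|z\rangle(|4\rangle+|6\rangle)\bigr)|\omega\rangle,\qquad |\psi_{z,1}\rangle=|\psi_{z,0}\rangle^*\qquad(z\in\{0,1\}).$$ Consider simple graphs $g$ on the 128 vertices $(z,t,j)$, $z\in\{0,1\}$, $t\in\{1,\dots,8\}$, $j\in\{0,\dots,7\}$, with the property (P) the smallest eigenvalue of the adjacency matrix $A(g)$ is $e_1$, and its eigenspace is the span of $|\psi_{z,a}\rangle$, $z,a\in\{0,1\}$. One such graph is $g_0$, defined as follows. Let $U_1=U_2=U_7=U_8=H$, $U_3=U_5=HT$, $U_4=U_6=(HT)^\dagger$; every entry of $-\sqrt2\,U_t$ is a power $e^{i\pi k/4}$.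 Let $S$ be the cyclic shift $|j\rangle\mapsto|j+1\bmod 8\rangle$ and let $B_t$ be obtained from $-\sqrt2\,U_t$ by replacing each entry $e^{i\pi k/4}$ by $S^k$. Then $A(g_0)=\sum_{t=1}^8\bigl(B_t\otimes|t+1\rangle\langle t|+\text{h.c.}\bigr)+1\otimes1\otimes(S^3+S^4+S^5)$, where $|9\rangle=|1\rangle$ and $B_t$ acts on the registers $z$ and $j$. *Gate graphs.* A gate diagram consists of $R$ diagram elements, each labelled $1$, $H$ or $HT$, a set $\mathcal S$ of nodes (self-loops) and a set $\mathcal E$ of unordered pairs of distinct nodes (edges). The nodes of the $q$-th element, $q\in\{1,\dots,R\}$, are the triples $(q,z,t)$ with $z\in\{0,1\}$ and $t\in\{1,3,5,7\}$, $\{1,3,2,8\}$ or $\{1,3,4,6\}$ for label $1$, $H$, $HT$ respectively. Each node has at most one incident edge or self-loop, and never both. For $g$ with (P), the associated gate graph $G$ has vertices $(q,z,t,j)$ and adjacency matrix $$A(G)=1_q\otimes A(g)+\sum_{n\in\mathcal S}|n\rangle\langle n|\otimes1_j+\sum_{\{n,n'\}\in\mathcal E}(|n\rangle+|n'\rangle)(\langle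 n|+\langle n'|)\otimes1_j .$$ $G$ is an $e_1$-gate graph if the smallest eigenvalue of $A(G)$ is $e_1$. Let $\mathcal N$ be the set of vertices $(q,z,t,j)$ such that $(q,z,t)$ is not in $\mathcal S$ and lies on no edge of $\mathcal E$, let $\Pi_{\mathcal N}=\sum_{v\in\mathcal N}|v\rangle\langle v|$ and $\Pi_+=\frac12(|0\rangle+|1\rangle)(\langle0|+\langle1|)$, and define the graph $G^{\mathrm{SL}}$, on two copies of the vertex set of $G$, by $$A(G^{\mathrm{SL}})=A(G)\otimes1+2\,\Pi_{\mathcal N}\otimes\Pi_+ .$$ For a matrix $M$ let $\gamma(M)$ denote its smallest nonzero eigenvalue. **Lemma.** The graph $g_0$ has property (P). There is an absolute constant $C>0$ such that for every $g$ with property (P) (in particular for $g=g_0$), every $R$ and every gate diagram with $R$ elements whose gate graph $G$ is an $e_1$-gate graph, $A(G)-e_1$ and $A(G^{\mathrm{SL}})-e_1$ have nonzero eigenvalues and $$\gamma\bigl(A(G^{\mathrm{SL}})-e_1\bigr)\ \ge\ C\,\gamma\bigl(A(G)-e_1\bigr).$$ -/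

import Mathlib

open scoped Kronecker ComplexConjugate

namespace GateGraph

noncomputable section

/-! ### Eigenvalues -/

/-- The real eigenvalues of a complex square matrix (all its eigenvalues, if it is Hermitian). -/
def eigenvalueSet {n : Type*} [Fintype n] [DecidableEq n] (A : Matrix n n ℂ) : Set ℝ :=
  {μ | Module.End.HasEigenvalue (Matrix.toLin' A) (μ : ℂ)}

/-- `c` is the smallest nonzero eigenvalue `γ(A)` of `A`; in particular a nonzero eigenvalue
exists. -/
def IsSmallestNonzeroEigenvalue {n : Type*} [Fintype n] [DecidableEq n]
    (A : Matrix n n ℂ) (c : ℝ) : Prop :=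
  IsLeast (eigenvalueSet A \ {0}) c

/-- `e₁ = -1 - 3√2`. -/
def e1 : ℝ := -1 - 3 * √2

/-! ### The graph `g₀` -/

/-- The labels `(z, t, j)` of the 128 vertices of `g₀`. The label `t ∈ {1, …, 8}` is represented
by its residue modulo 8 in `Fin 8` (so `t = 8` is the numeral `8 = 0`), and `j ∈ {0, …, 7}`. -/
abbrev Vertex0 : Type := Fin 2 × Fin 8 × Fin 8

/-- The Hadamard gate. -/
def gateH : Matrix (Fin 2) (Fin 2) ℂ := ((1 / √2 : ℝ) : ℂ) • !![1, 1; 1, -1]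

/-- The `T` gate `diag(1, e^{iπ/4})`. -/
def gateT : Matrix (Fin 2) (Fin 2) ℂ := !![1, 0; 0, Complex.exp (Complex.I * Real.pi / 4)]

/-- The unitary applied to the first register at `t`: `H` for `t = 2, 8`, `HT` for `t = 4, 6`, and
the identity for `t = 1, 3, 5, 7`. -/
def stepUnitary (t : Fin 8) : Matrix (Fin 2) (Fin 2) ℂ :=
  if t = 2 ∨ t = 8 then gateH else if t = 4 ∨ t = 6 then gateH * gateT else 1

/-- The state `|ω⟩ = 8^{-1/2} ∑ⱼ e^{-iπj/4} |j⟩`. -/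
def omegaState (j : Fin 8) : ℂ :=
  ((1 / √8 : ℝ) : ℂ) * Complex.exp (-(Complex.I * Real.pi / 4 * ((j : ℕ) : ℂ)))

/-- The states `|ψ_{z,0}⟩` and `|ψ_{z,1}⟩ = |ψ_{z,0}⟩^*`. -/
def psi (z a : Fin 2) : Vertex0 → ℂ := fun v =>
  let w : ℂ := ((1 / √8 : ℝ) : ℂ) * stepUnitary v.2.1 v.1 z * omegaState v.2.2
  if a = 0 then w else conj w

/-- The spectral description of `g₀`: the smallest eigenvalue of its adjacency matrix is `e₁`, and
the corresponding eigenspace is spanned by the four (orthonormal) states `|ψ_{z,a}⟩`. -/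
structure HasG0Spectrum (g : SimpleGraph Vertex0) [DecidableRel g.Adj] : Prop where
  isLeast_e1 : IsLeast (eigenvalueSet (g.adjMatrix ℂ)) e1
  eigenspace_e1 : Module.End.eigenspace (Matrix.toLin' (g.adjMatrix ℂ)) (e1 : ℂ) =
    Submodule.span ℂ (Set.range fun za : Fin 2 × Fin 2 => psi za.1 za.2)

/-- Exponents of the hopping terms of `g₀`. Let `U_t` be the gate leading from `t` to `t + 1` in
the cyclic sequence `1, H, 1, HT, 1, HT, 1, H` (for `t = 1, …, 8`), that is
`U_t = H` for `t = 1, 2, 7, 8`, `U_t = HT` for `t = 3, 5`, `U_t = (HT)†` for `t = 4, 6`.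
Then `(-√2 U_t)_{x,z} = e^{iπk/4}` with `k = hopExponent t x z`. -/
def hopExponent (t : Fin 8) (x z : Fin 2) : Fin 8 :=
  if t = 3 ∨ t = 5 then !![4, 5; 4, 1] x z
  else if t = 4 ∨ t = 6 then !![4, 4; 3, 7] x z
  else !![4, 4; 4, 0] x z

/-- The graph `g₀`. With `S` the cyclic shift `|j⟩ ↦ |j + 1⟩`, its adjacency matrix is obtained
from `-√2 ∑ₜ (U_t ⊗ |t + 1⟩⟨t| + h.c.)` by replacing each nonzero entry `e^{iπk/4}` by `S^k`, and
adding `S³ + S⁴ + S⁵` on the third register. -/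
def g0 : SimpleGraph Vertex0 :=
  SimpleGraph.fromRel fun u v =>
    (v.2.1 = u.2.1 + 1 ∧ v.2.2 = u.2.2 + hopExponent u.2.1 v.1 u.1) ∨
    (v.1 = u.1 ∧ v.2.1 = u.2.1 ∧ (v.2.2 = u.2.2 + 3 ∨ v.2.2 = u.2.2 + 4))

instance : DecidableRel g0.Adj := fun u v =>
  inferInstanceAs (Decidable ((SimpleGraph.fromRel _).Adj u v))

/-! ### Gate diagrams and gate graphs -/

/-- The unitary labels `1`, `H`, `HT` of diagram elements. -/
inductive ElementLabel : Type
  | one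
  | H
  | HT

/-- The values of `t` for which the nodes `(z, t)` appear in a diagram element. -/
def ElementLabel.times : ElementLabel → Finset (Fin 8)
  | .one => {1, 3, 5, 7}
  | .H => {1, 3, 2, 8}
  | .HT => {1, 3, 4, 6}

/-- Node labels `(q, z, t)`. -/
abbrev Node (R : ℕ) : Type := Fin R × Fin 2 × Fin 8

/-- Vertices `(q, z, t, j)` of a gate graph. -/
abbrev Vertex (R : ℕ) : Type := Fin R × Vertex0

/-- A gate diagram with `R` diagram elements: a unitary label for each element, a set `S` of nodes
with self-loops and a set `E` of edges (unordered pairs of distinct nodes). Each node has at most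
one incident edge or self-loop, and never both. -/
structure GateDiagram (R : ℕ) where
  label : Fin R → ElementLabel
  S : Finset (Node R)
  E : Finset (Sym2 (Node R))
  mem_times_of_mem_S : ∀ n ∈ S, n.2.2 ∈ (label n.1).times
  mem_times_of_mem_E : ∀ e ∈ E, ∀ n ∈ e, n.2.2 ∈ (label n.1).times
  not_isDiag : ∀ e ∈ E, ¬ e.IsDiag
  not_mem_E_of_mem_S : ∀ n ∈ S, ∀ e ∈ E, n ∉ e
  edge_unique : ∀ e ∈ E, ∀ e' ∈ E, ∀ n, n ∈ e → n ∈ e' → e = e'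

/-- The node `(q, z, t)` of a vertex `(q, z, t, j)`. -/
def Vertex.node {R : ℕ} (v : Vertex R) : Node R := (v.1, v.2.1, v.2.2.1)

/-- The operator `|x⟩⟨x| ⊗ 1_j`, for a real vector `x` indexed by nodes. -/
def nodeOperator {R : ℕ} (x : Node R → ℂ) : Matrix (Vertex R) (Vertex R) ℂ :=
  (Matrix.vecMulVec x x ⊗ₖ (1 : Matrix (Fin 8) (Fin 8) ℂ)).submatrix
    (fun v => (Vertex.node v, v.2.2.2)) (fun v => (Vertex.node v, v.2.2.2))

namespace GateDiagram

variable {R : ℕ} (D : GateDiagram R)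

/-- `h_S = ∑_{n ∈ S} |n⟩⟨n| ⊗ 1_j`. -/
def hS : Matrix (Vertex R) (Vertex R) ℂ :=
  ∑ n ∈ D.S, nodeOperator (Pi.single n 1)

/-- `h_E = ∑_{{n, n'} ∈ E} (|n⟩ + |n'⟩)(⟨n| + ⟨n'|) ⊗ 1_j`. -/
def hE : Matrix (Vertex R) (Vertex R) ℂ :=
  ∑ e ∈ D.E, nodeOperator (fun n => if n ∈ e then 1 else 0)

/-- The adjacency matrix `A(G) = 1_q ⊗ A(g) + h_S + h_E` of the gate graph of the diagram `D`
built on the graph `g`. -/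
def adj (g : SimpleGraph Vertex0) [DecidableRel g.Adj] : Matrix (Vertex R) (Vertex R) ℂ :=
  (1 : Matrix (Fin R) (Fin R) ℂ) ⊗ₖ g.adjMatrix ℂ + D.hS + D.hE

/-- The gate graph is an `e₁`-gate graph: the smallest eigenvalue of `A(G)` is `e₁`. -/
def IsE1GateGraph (g : SimpleGraph Vertex0) [DecidableRel g.Adj] : Prop :=
  IsLeast (eigenvalueSet (D.adj g)) e1

/-- The set `𝒩` of vertices without self-loops in the gate graph. -/
def noLoop : Set (Vertex R) :=
  {v | Vertex.node v ∉ D.S ∧ ∀ n' : Node R, s(Vertex.node v, n') ∉ D.E}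

open Classical in
/-- The projector `Π_𝒩`. -/
def projNoLoop : Matrix (Vertex R) (Vertex R) ℂ :=
  Matrix.diagonal fun v => if v ∈ D.noLoop then 1 else 0

/-- The adjacency matrix `A(G^SL) = A(G) ⊗ 1_d + 2 Π_𝒩 ⊗ Π_+`, where
`Π_+ = ½ (|0⟩ + |1⟩)(⟨0| + ⟨1|)`. -/
def adjSL (g : SimpleGraph Vertex0) [DecidableRel g.Adj] :
    Matrix (Vertex R × Fin 2) (Vertex R × Fin 2) ℂ :=
  D.adj g ⊗ₖ (1 : Matrix (Fin 2) (Fin 2) ℂ) +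
    (2 : ℂ) • (D.projNoLoop ⊗ₖ ((1 / 2 : ℂ) • !![1, 1; 1, 1]))

end GateDiagram

end

end GateGraph

/-! Write `M` for A(G) - e₁ and Π for the projector onto 𝒩. Splitting the doubled space into
antisymmetric and symmetric vectors turns A(G^SL) - e₁ into the direct sum of `M` and `M` + 2Π. The
first summand has gap γ(M), so everything rests on bounding `M` + 2Π below.

Two facts give the bound γ/56 (`eigenvalue_add_projection_ge`). First, Π keeps at least an eighth of
the squared norm of every kernel vector of `M`. Indeed `M` is 1 ⊗ (A(g) - e₁) plus positive
semidefinite terms, so a kernel vector restricts on each element to the span of the ψ states. Such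
vectors have equal weight at all eight values of t, and every element leaves some t without nodes,
hence entirely in 𝒩. Second, γ ≤ 7, by a test vector at that same t. A vector is then either far
from the kernel, where `M` is large, or close to it, where Π is large.

For g₀, the cyclic symmetry in j splits the adjacency matrix into eight blocks. In the blocks of
characters other than 1 and 7 a Gershgorin bound keeps eigenvalues above e₁. In block 1 the hopping
matrices become -√2 U_t, and U_t = V_{t+1} V_t† with V_t = `stepUnitary t`; a change of gauge by V_t
leaves the Laplacian-type problem on an 8-cycle, whose extremal eigenvectors are constant. Block 7
is the complex conjugate of block 1. -/

namespace GateGraph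

open Matrix
open scoped ComplexOrder

/-! ### Spectral bounds for Hermitian and positive semidefinite matrices -/

section Spectral

variable {n : Type*} [Fintype n]

lemma re_star_dotProduct_self (x : n → ℂ) :
    (star x ⬝ᵥ x).re = ∑ i, Complex.normSq (x i) := by
  simp [dotProduct, Complex.normSq_apply]

lemma re_star_dotProduct_self_pos {x : n → ℂ} (hx : x ≠ 0) : 0 < (star x ⬝ᵥ x).re := by
  obtain ⟨i, hi⟩ := Function.ne_iff.1 hx
  rw [re_star_dotProduct_self]
  exact Finset.sum_pos' (fun i _ => Complex.normSq_nonneg _)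
    ⟨i, Finset.mem_univ i, Complex.normSq_pos.2 hi⟩

lemma eq_zero_of_re_star_dotProduct_self {x : n → ℂ} (hx : (star x ⬝ᵥ x).re = 0) : x = 0 := by
  by_contra h
  exact (re_star_dotProduct_self_pos h).ne' hx

lemma mulVec_eq_zero_of_posSemidef_add {A B : Matrix n n ℂ} (hA : A.PosSemidef)
    (hB : B.PosSemidef) {x : n → ℂ} (h : (A + B) *ᵥ x = 0) : A *ᵥ x = 0 := by
  rw [← hA.dotProduct_mulVec_zero_iff]
  have h0 : star x ⬝ᵥ A *ᵥ x + star x ⬝ᵥ B *ᵥ x = 0 := by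
    rw [← dotProduct_add, ← add_mulVec, h, dotProduct_zero]
  have h1 := hA.dotProduct_mulVec_nonneg x
  have h2 := hB.dotProduct_mulVec_nonneg x
  exact ((add_eq_zero_iff_of_nonneg h1 h2).1 h0).1

variable [DecidableEq n]

lemma mem_eigenvalueSet_iff {A : Matrix n n ℂ} {μ : ℝ} :
    μ ∈ eigenvalueSet A ↔ ∃ x : n → ℂ, x ≠ 0 ∧ A *ᵥ x = (μ : ℂ) • x := by
  constructor
  · intro h
    obtain ⟨x, hx⟩ := Module.End.HasEigenvalue.exists_hasEigenvector h
    exact ⟨x, hx.2, by simpa using hx.apply_eq_smul⟩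
  · rintro ⟨x, hx, h⟩
    exact Module.End.hasEigenvalue_of_hasEigenvector
      ⟨Module.End.mem_eigenspace_iff.2 (by simpa using h), hx⟩

lemma mem_eigenvalueSet_sub_iff {A : Matrix n n ℂ} {μ c : ℝ} :
    μ ∈ eigenvalueSet (A - (c : ℂ) • 1) ↔ μ + c ∈ eigenvalueSet A := by
  simp only [mem_eigenvalueSet_iff, sub_mulVec, smul_mulVec, one_mulVec, sub_eq_iff_eq_add,
    Complex.ofReal_add, add_smul]

lemma finite_eigenvalueSet (A : Matrix n n ℂ) : (eigenvalueSet A).Finite :=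
  (Module.End.finite_hasEigenvalue (Matrix.toLin' A)).preimage Complex.ofReal_injective.injOn

lemma exists_isSmallestNonzeroEigenvalue {A : Matrix n n ℂ} {μ : ℝ}
    (h : μ ∈ eigenvalueSet A) (hμ : μ ≠ 0) : ∃ c, IsSmallestNonzeroEigenvalue A c := by
  obtain ⟨c, hc, hc'⟩ := Set.exists_min_image (eigenvalueSet A \ {0}) id
    ((finite_eigenvalueSet A).subset Set.sdiff_subset) ⟨μ, h, hμ⟩
  exact ⟨c, hc, fun b hb => hc' b hb⟩

lemma eigenvalues_mem_eigenvalueSet {A : Matrix n n ℂ} (hA : A.IsHermitian) (i : n) :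
    hA.eigenvalues i ∈ eigenvalueSet A := by
  refine mem_eigenvalueSet_iff.2 ⟨_, ?_, hA.mulVec_eigenvectorBasis i⟩
  intro h
  exact hA.eigenvectorBasis.toBasis.ne_zero i (by ext j; simpa using congrFun h j)

lemma posSemidef_of_eigenvalueSet_nonneg {A : Matrix n n ℂ} (hA : A.IsHermitian)
    (h : ∀ μ ∈ eigenvalueSet A, 0 ≤ μ) : A.PosSemidef :=
  hA.posSemidef_iff_eigenvalues_nonneg.2 fun i => h _ (eigenvalues_mem_eigenvalueSet hA i)

lemma posSemidef_sub_of_isLeast {A : Matrix n n ℂ} {c : ℝ} (hA : A.IsHermitian)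
    (h : IsLeast (eigenvalueSet A) c) : (A - (c : ℂ) • 1).PosSemidef := by
  refine posSemidef_of_eigenvalueSet_nonneg ?_ fun μ hμ => ?_
  · refine hA.sub ?_
    simp [IsHermitian, conjTranspose_smul]
  · have := h.2 (mem_eigenvalueSet_sub_iff.1 hμ)
    linarith

/-- Splitting a vector into a component in the kernel of a Hermitian matrix and an orthogonal
component, on which the matrix is bounded below by any lower bound `γ` of its nonzero
eigenvalues. -/
lemma exists_kernel_decomposition {M : Matrix n n ℂ} (hM : M.IsHermitian) {γ : ℝ}
    (hγ : γ ∈ lowerBounds (eigenvalueSet M \ {0})) (x : n → ℂ) :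
    ∃ k y : n → ℂ, x = k + y ∧ M *ᵥ k = 0 ∧ star k ⬝ᵥ y = 0 ∧
      γ * (star y ⬝ᵥ y).re ≤ (star x ⬝ᵥ M *ᵥ x).re := by
  set U : Matrix n n ℂ := (hM.eigenvectorUnitary : Matrix n n ℂ) with hU
  set ev := hM.eigenvalues with hev
  set Dg : Matrix n n ℂ := diagonal (fun i => (ev i : ℂ)) with hDg
  have hUU : Uᴴ * U = 1 := by
    simpa [star_eq_conjTranspose] using Unitary.coe_star_mul_self hM.eigenvectorUnitary
  have hUU' : U * Uᴴ = 1 := by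
    simpa [star_eq_conjTranspose] using Unitary.coe_mul_star_self hM.eigenvectorUnitary
  have hspec : M = U * Dg * Uᴴ := by
    have := hM.spectral_theorem
    simpa [Unitary.conjStarAlgAut_apply, star_eq_conjTranspose, Function.comp_def] using this
  set c : n → ℂ := Uᴴ *ᵥ x with hc
  set c₀ : n → ℂ := fun i => if ev i = 0 then c i else 0 with hc₀
  set c₁ : n → ℂ := fun i => if ev i = 0 then 0 else c i with hc₁
  have hsum : c = c₀ + c₁ := by
    ext i; by_cases h : ev i = 0 <;> simp [hc₀, hc₁, h]
  have hdot : ∀ a b : n → ℂ, star (U *ᵥ a) ⬝ᵥ (U *ᵥ b) = star a ⬝ᵥ b := by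
    intro a b
    rw [star_mulVec, ← dotProduct_mulVec, mulVec_mulVec, hUU, one_mulVec]
  have hx : U *ᵥ c = x := by rw [hc, mulVec_mulVec, hUU', one_mulVec]
  refine ⟨U *ᵥ c₀, U *ᵥ c₁, ?_, ?_, ?_, ?_⟩
  · rw [← mulVec_add, ← hsum, hx]
  · rw [hspec, mulVec_mulVec, Matrix.mul_assoc, hUU, Matrix.mul_one, ← mulVec_mulVec]
    have : Dg *ᵥ c₀ = 0 := by
      ext i; by_cases h : ev i = 0 <;> simp [hDg, mulVec_diagonal, hc₀, h]
    rw [this, mulVec_zero]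
  · rw [hdot]
    refine Finset.sum_eq_zero fun i _ => ?_
    by_cases h : ev i = 0 <;> simp [hc₀, hc₁, h]
  · have hMx : star x ⬝ᵥ M *ᵥ x = star c ⬝ᵥ Dg *ᵥ c := by
      calc star x ⬝ᵥ M *ᵥ x = star x ⬝ᵥ (U * Dg * Uᴴ) *ᵥ x := by rw [← hspec]
        _ = star x ⬝ᵥ U *ᵥ Dg *ᵥ c := by rw [hc, mulVec_mulVec, mulVec_mulVec, Matrix.mul_assoc]
        _ = star c ⬝ᵥ Dg *ᵥ c := by
          rw [dotProduct_mulVec, hc, star_mulVec, conjTranspose_conjTranspose]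
    rw [hdot, hMx]
    simp only [dotProduct, Complex.re_sum, Finset.mul_sum, hDg, mulVec_diagonal, Pi.star_apply]
    refine Finset.sum_le_sum fun i _ => ?_
    have hn : ∀ z : ℂ, (star z * z).re = Complex.normSq z := fun z => by
      simp [Complex.normSq_apply]
    have hn' : (star (c i) * ((ev i : ℂ) * c i)).re = ev i * Complex.normSq (c i) := by
      rw [← hn, mul_left_comm, Complex.re_ofReal_mul]
    rw [hn, hn']
    by_cases h : ev i = 0
    · simp [hc₁, h]
    · simp only [hc₁, h, if_false]
      exact mul_le_mul_of_nonneg_right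
        (hγ ⟨eigenvalues_mem_eigenvalueSet hM i, h⟩) (Complex.normSq_nonneg _)

/-- A lower bound on the eigenvalues of `M + 2P`, where `M` is positive semidefinite and `P` is a
coordinate projection retaining at least an eighth of the squared norm of each kernel vector of
`M`. -/
lemma eigenvalue_add_projection_ge {M : Matrix n n ℂ} (hM : M.PosSemidef) {γ : ℝ}
    (hγ : γ ∈ lowerBounds (eigenvalueSet M \ {0})) (hγ7 : γ ≤ 7)
    (p : n → Prop) [DecidablePred p]
    (hp : ∀ k : n → ℂ, M *ᵥ k = 0 →
      ∑ i, Complex.normSq (k i) ≤ 8 * ∑ i, if p i then Complex.normSq (k i) else 0)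
    {x : n → ℂ} (hx : x ≠ 0) {μ : ℝ}
    (h : (M + (2 : ℂ) • diagonal fun i => if p i then 1 else 0) *ᵥ x = (μ : ℂ) • x) :
    1 / 56 * γ ≤ μ := by
  obtain ⟨k, y, hxky, hk, hky, hquad⟩ := exists_kernel_decomposition hM.1 hγ x
  have hpos := re_star_dotProduct_self_pos hx
  have hxx : (star x ⬝ᵥ x).re = (star k ⬝ᵥ k).re + (star y ⬝ᵥ y).re := by
    have hyk : star y ⬝ᵥ k = 0 := by
      rw [star_dotProduct, hky, star_zero]
    rw [hxky, star_add, add_dotProduct, dotProduct_add, dotProduct_add, hky, hyk]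
    simp
  have hP : (star x ⬝ᵥ (diagonal fun i => if p i then (1 : ℂ) else 0) *ᵥ x).re =
      ∑ i, if p i then Complex.normSq (x i) else 0 := by
    simp only [dotProduct, Complex.re_sum, mulVec_diagonal, Pi.star_apply]
    refine Finset.sum_congr rfl fun i _ => ?_
    by_cases hi : p i <;> simp [hi, Complex.normSq_apply]
  have hμ : μ * (star x ⬝ᵥ x).re = (star x ⬝ᵥ M *ᵥ x).re +
      2 * ∑ i, if p i then Complex.normSq (x i) else 0 := by
    have := congrArg (fun w => (star x ⬝ᵥ w).re) h
    simp only [add_mulVec, smul_mulVec, dotProduct_add, dotProduct_smul, smul_eq_mul,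
      Complex.add_re, Complex.re_ofReal_mul] at this
    rw [← this, ← hP]
    simp
  -- Coordinatewise k = x - y, so |k|² ≤ 2|x|² + 2|y|² wherever `p` holds.
  have hkp : (∑ i, if p i then Complex.normSq (k i) else 0) ≤
      2 * (∑ i, if p i then Complex.normSq (x i) else 0) + 2 * (star y ⬝ᵥ y).re := by
    rw [re_star_dotProduct_self, Finset.mul_sum, Finset.mul_sum, ← Finset.sum_add_distrib]
    refine Finset.sum_le_sum fun i _ => ?_
    have hi : k i = x i - y i := by rw [hxky]; simp
    have hy := Complex.normSq_nonneg (y i)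
    split_ifs
    · rw [hi]
      simp only [Complex.normSq_apply, Complex.sub_re, Complex.sub_im]
      nlinarith [sq_nonneg ((x i).re + (y i).re), sq_nonneg ((x i).im + (y i).im)]
    · linarith
  have hk8 := hp k hk
  rw [← re_star_dotProduct_self] at hk8
  have hpx : 0 ≤ ∑ i, if p i then Complex.normSq (x i) else 0 :=
    Finset.sum_nonneg fun i _ => by split_ifs <;> simp [Complex.normSq_nonneg]
  have hyy : 0 ≤ (star y ⬝ᵥ y).re := by
    rw [re_star_dotProduct_self]
    exact Finset.sum_nonneg fun i _ => Complex.normSq_nonneg _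
  have hMx : 0 ≤ (star x ⬝ᵥ M *ᵥ x).re := (Complex.le_def.1 (hM.dotProduct_mulVec_nonneg x)).1
  generalize (∑ i, if p i then Complex.normSq (x i) else 0) = a at *
  rcases le_or_gt γ 0 with h0 | h0
  · have : 0 ≤ μ := by
      by_contra hneg
      nlinarith
    linarith
  · refine le_of_mul_le_mul_right ?_ hpos
    rw [hμ]
    -- Let K and Y be the squared norms of `k` and `y`. Then K ≤ 8(2a + 2Y), so γ(K + Y)/56 ≤
    -- (16γ/56)a + (17γ/56)Y. This is at most 2a + γY, where 16γ/56 ≤ 2 is exactly γ ≤ 7.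
    nlinarith

end Spectral

/-! ### The unitaries and the state `|ω⟩` -/

/-- The primitive eighth root of unity `e^{iπ/4}`. -/
noncomputable def zeta : ℂ := Complex.exp (Complex.I * Real.pi / 4)

lemma zeta_eq : zeta = ((√2 / 2 : ℝ) : ℂ) * (1 + Complex.I) := by
  have : Complex.I * Real.pi / 4 = ((Real.pi / 4 : ℝ) : ℂ) * Complex.I := by push_cast; ring
  rw [zeta, this, Complex.exp_mul_I, ← Complex.ofReal_cos, ← Complex.ofReal_sin,
    Real.cos_pi_div_four, Real.sin_pi_div_four]
  ring

lemma ofReal_sqrt_two_sq : ((√2 : ℝ) : ℂ) ^ 2 = 2 := by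
  rw [← Complex.ofReal_pow, Real.sq_sqrt (by norm_num)]; norm_num

lemma zeta_sq : zeta ^ 2 = Complex.I := by
  rw [zeta_eq]
  push_cast
  linear_combination ((1 + Complex.I) ^ 2 / 4) * ofReal_sqrt_two_sq + (1 / 2) * Complex.I_sq

lemma zeta_pow_four : zeta ^ 4 = -1 := by
  rw [show 4 = 2 * 2 from rfl, pow_mul, zeta_sq, Complex.I_sq]

lemma zeta_mul_conj : zeta * conj zeta = 1 := by
  rw [zeta_eq]
  simp only [map_mul, Complex.conj_ofReal, map_add, map_one, Complex.conj_I]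
  push_cast
  linear_combination ((1 - Complex.I ^ 2) / 4) * ofReal_sqrt_two_sq - (1 / 2) * Complex.I_sq

lemma conj_zeta : conj zeta = -zeta ^ 3 := by
  linear_combination (-zeta ^ 3) * zeta_mul_conj + conj zeta * zeta_pow_four

lemma zeta_add_conj : zeta + conj zeta = ((√2 : ℝ) : ℂ) := by
  rw [zeta_eq]
  simp only [map_mul, Complex.conj_ofReal, map_add, map_one, Complex.conj_I]
  push_cast
  ring

lemma omegaState_eq (j : Fin 8) :
    omegaState j = ((1 / √8 : ℝ) : ℂ) * conj zeta ^ (j : ℕ) := by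
  rw [omegaState, zeta, ← Complex.exp_conj, ← Complex.exp_nat_mul]
  congr 2
  simp only [map_div₀, map_mul, Complex.conj_I, Complex.conj_ofReal, map_ofNat]
  ring

lemma ofReal_inv_sqrt_eight_sq : ((1 / √8 : ℝ) : ℂ) ^ 2 = 1 / 8 := by
  rw [← Complex.ofReal_pow, div_pow, Real.sq_sqrt (by norm_num)]; norm_num

lemma ofReal_inv_sqrt_two_sq : ((1 / √2 : ℝ) : ℂ) ^ 2 = 1 / 2 := by
  rw [← Complex.ofReal_pow, div_pow, Real.sq_sqrt (by norm_num)]; norm_num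

/-- The state ω and its conjugate are orthonormal: the cross terms are multiples of the sums of iʲ
and (-i)ʲ over two full periods, which vanish. -/
lemma sum_normSq_omegaState (α β : ℂ) :
    ∑ j, Complex.normSq (α * omegaState j + β * conj (omegaState j)) =
      Complex.normSq α + Complex.normSq β := by
  apply Complex.ofReal_injective
  have hterm : ∀ j : Fin 8,
      ((Complex.normSq (α * omegaState j + β * conj (omegaState j)) : ℝ) : ℂ) =
      1 / 8 * (conj α * α + conj β * β) +
        1 / 8 * (conj α * β * Complex.I ^ (j : ℕ) + conj β * α * conj Complex.I ^ (j : ℕ)) := by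
    intro j
    have h1 : zeta ^ (j : ℕ) * conj zeta ^ (j : ℕ) = 1 := by
      rw [← mul_pow, zeta_mul_conj, one_pow]
    rw [← zeta_sq, map_pow, ← pow_mul, ← pow_mul, mul_comm 2, pow_mul, pow_mul,
      ← ofReal_inv_sqrt_eight_sq, Complex.normSq_eq_conj_mul_self, omegaState_eq]
    simp only [map_add, map_mul, map_pow, Complex.conj_conj, Complex.conj_ofReal]
    linear_combination ((1 / √8 : ℝ) : ℂ) ^ 2 * (conj α * α + conj β * β) * h1
  rw [Complex.ofReal_sum]
  simp only [hterm, Fin.sum_univ_eight, Complex.conj_I]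
  push_cast [Complex.normSq_eq_conj_mul_self]
  have h2 := Complex.I_sq
  simp only [Fin.isValue, Fin.coe_ofNat_eq_mod, Nat.reduceMod]
  linear_combination (1 / 8 * (conj α * β) * (1 + Complex.I) * (1 + Complex.I ^ 4) +
    1 / 8 * (conj β * α) * (1 - Complex.I) * (1 + Complex.I ^ 4)) * h2

lemma gateH_mul_self : gateHᴴ * gateH = 1 := by
  have h := ofReal_inv_sqrt_two_sq
  ext i j
  fin_cases i <;> fin_cases j <;>
    simp only [gateH, mul_apply, Fin.sum_univ_two] <;> simp <;>
    · simp at h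
      field_simp at h ⊢
      linear_combination -h

lemma gateT_mul_self : gateTᴴ * gateT = 1 := by
  have h := zeta_mul_conj
  rw [zeta] at h
  ext i j
  fin_cases i <;> fin_cases j <;> simp [gateT, mul_apply, Fin.sum_univ_two]
  rw [mul_comm]; exact h

lemma stepUnitary_mul_self (t : Fin 8) : (stepUnitary t)ᴴ * stepUnitary t = 1 := by
  unfold stepUnitary
  split_ifs
  · exact gateH_mul_self
  · rw [conjTranspose_mul, Matrix.mul_assoc, ← Matrix.mul_assoc gateHᴴ, gateH_mul_self,
      Matrix.one_mul, gateT_mul_self]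
  · simp

lemma sum_normSq_mulVec {n : Type*} [Fintype n] [DecidableEq n] {U : Matrix n n ℂ}
    (hU : Uᴴ * U = 1) (a : n → ℂ) :
    ∑ z, Complex.normSq ((U *ᵥ a) z) = ∑ z, Complex.normSq (a z) := by
  rw [← re_star_dotProduct_self, ← re_star_dotProduct_self, star_mulVec, ← dotProduct_mulVec,
    mulVec_mulVec, hU, one_mulVec]

/-! ### The span of the states `|ψ_{z,a}⟩` -/

/-- The span of the four states `|ψ_{z,a}⟩`. -/
noncomputable def psiSpan : Submodule ℂ (Vertex0 → ℂ) :=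
  Submodule.span ℂ (Set.range fun za : Fin 2 × Fin 2 => psi za.1 za.2)

/-- The second amplitude enters through a conjugate, so that both parts are governed by the same
`stepUnitary t`. -/
lemma mem_psiSpan_iff {f : Vertex0 → ℂ} : f ∈ psiSpan ↔ ∃ a b : Fin 2 → ℂ, ∀ z t j,
    f (z, t, j) = (stepUnitary t *ᵥ a) z * omegaState j +
      conj ((stepUnitary t *ᵥ b) z) * conj (omegaState j) := by
  have h8 : ((1 / √8 : ℝ) : ℂ) ≠ 0 := by
    intro h
    have := ofReal_inv_sqrt_eight_sq
    rw [h] at this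
    norm_num at this
  rw [psiSpan, Submodule.mem_span_range_iff_exists_fun]
  constructor
  · rintro ⟨c, rfl⟩
    refine ⟨fun z => ((1 / √8 : ℝ) : ℂ) * c (z, 0), fun z => ((1 / √8 : ℝ) : ℂ) * conj (c (z, 1)),
      fun z t j => ?_⟩
    simp only [Fintype.sum_prod_type, Fin.sum_univ_two, psi, mulVec, dotProduct, Pi.add_apply,
      Pi.smul_apply, smul_eq_mul, map_add, map_mul, Complex.conj_conj, Complex.conj_ofReal, if_true,
      one_ne_zero, if_false]
    ring
  · rintro ⟨a, b, h⟩
    refine ⟨fun za => ((1 / √8 : ℝ) : ℂ)⁻¹ * if za.2 = 0 then a za.1 else conj (b za.1), ?_⟩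
    ext ⟨z, t, j⟩
    rw [h]
    simp only [Fintype.sum_prod_type, Fin.sum_univ_two, psi, mulVec, dotProduct, Pi.add_apply,
      Pi.smul_apply, smul_eq_mul, map_add, map_mul, Complex.conj_ofReal, if_true, one_ne_zero,
      if_false]
    generalize ((1 / √8 : ℝ) : ℂ) = r at *
    field_simp
    ring

/-- At each t the weight is |a|² + |b|², because `stepUnitary t` is unitary and ω, ω* are
orthonormal. -/
lemma sum_normSq_of_mem_psiSpan {f : Vertex0 → ℂ} (hf : f ∈ psiSpan) (t t' : Fin 8) :
    ∑ z, ∑ j, Complex.normSq (f (z, t, j)) = ∑ z, ∑ j, Complex.normSq (f (z, t', j)) := by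
  obtain ⟨a, b, h⟩ := mem_psiSpan_iff.1 hf
  simp only [h, sum_normSq_omegaState, Complex.normSq_conj, Finset.sum_add_distrib,
    sum_normSq_mulVec (stepUnitary_mul_self _)]

/-- A shift of j by 4 multiplies both ω and ω* by -1. This supplies a short vector orthogonal to the
kernel. -/
lemma add_eq_zero_of_mem_psiSpan {f : Vertex0 → ℂ} (hf : f ∈ psiSpan) (z : Fin 2) (t : Fin 8) :
    f (z, t, 0) + f (z, t, 4) = 0 := by
  obtain ⟨a, b, h⟩ := mem_psiSpan_iff.1 hf
  have h4 : omegaState 4 = -omegaState 0 := by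
    rw [omegaState_eq, omegaState_eq]
    have : conj zeta ^ 4 = -1 := by rw [← map_pow, zeta_pow_four]; simp
    simp [this]
  rw [h, h, h4, map_neg]
  ring

/-! ### Gate graphs -/

/-- A time at which a diagram element with the given label has no nodes. -/
def ElementLabel.unusedTime : ElementLabel → Fin 8
  | .one => 2
  | .H => 5
  | .HT => 5

lemma ElementLabel.unusedTime_notMem (l : ElementLabel) : l.unusedTime ∉ l.times := by
  cases l <;> decide

lemma nodeOperator_apply {R : ℕ} (x : Node R → ℂ) (v w : Vertex R) :
    nodeOperator x v w = x v.node * x w.node * (1 : Matrix (Fin 8) (Fin 8) ℂ) v.2.2.2 w.2.2.2 :=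
  rfl

lemma posSemidef_nodeOperator {R : ℕ} {x : Node R → ℂ} (hx : star x = x) :
    (nodeOperator x).PosSemidef := by
  have h := posSemidef_vecMulVec_self_star x
  rw [hx] at h
  exact (h.kronecker PosSemidef.one).submatrix _

lemma one_kronecker_mulVec {m n : Type*} [Fintype m] [Fintype n] [DecidableEq m]
    (B : Matrix n n ℂ) (x : m × n → ℂ) (q : m) (v : n) :
    (((1 : Matrix m m ℂ) ⊗ₖ B) *ᵥ x) (q, v) = (B *ᵥ fun w => x (q, w)) v := by
  simp [mulVec, dotProduct, Fintype.sum_prod_type, kroneckerMap_apply, one_apply, ite_mul]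

namespace GateDiagram

variable {R : ℕ} (D : GateDiagram R)

lemma posSemidef_hS : D.hS.PosSemidef := by
  refine posSemidef_sum _ fun n _ => posSemidef_nodeOperator ?_
  ext i
  by_cases h : i = n
  · subst h; simp
  · simp [h]

lemma posSemidef_hE : D.hE.PosSemidef := by
  refine posSemidef_sum _ fun e _ => posSemidef_nodeOperator ?_
  ext i
  by_cases h : i ∈ e <;> simp [h]

variable (g : SimpleGraph Vertex0) [DecidableRel g.Adj]

lemma isHermitian_adjMatrix : (g.adjMatrix ℂ).IsHermitian := by
  ext v w
  simp [conjTranspose_apply, SimpleGraph.adjMatrix_apply, g.adj_comm v w, apply_ite]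

lemma isHermitian_adj : (D.adj g).IsHermitian := by
  have h : ((1 : Matrix (Fin R) (Fin R) ℂ) ⊗ₖ g.adjMatrix ℂ).IsHermitian := by
    rw [IsHermitian, conjTranspose_kronecker, conjTranspose_one, (isHermitian_adjMatrix g).eq]
  exact (h.add D.posSemidef_hS.1).add D.posSemidef_hE.1

variable {D} in
lemma mem_noLoop_of_notMem_times {v : Vertex R} (hv : v.2.2.1 ∉ (D.label v.1).times) :
    v ∈ D.noLoop :=
  ⟨fun h => hv (D.mem_times_of_mem_S _ h),
    fun _ h => hv (D.mem_times_of_mem_E _ h v.node (Sym2.mem_mk_left _ _))⟩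

variable {D} in
lemma hS_apply_of_notMem_times {v : Vertex R} (hv : v.2.2.1 ∉ (D.label v.1).times)
    (w : Vertex R) : D.hS v w = 0 := by
  rw [hS, Matrix.sum_apply]
  refine Finset.sum_eq_zero fun n hn => ?_
  have : v.node ≠ n := fun h => hv (by subst h; exact D.mem_times_of_mem_S _ hn)
  simp [nodeOperator_apply, this]

variable {D} in
lemma hE_apply_of_notMem_times {v : Vertex R} (hv : v.2.2.1 ∉ (D.label v.1).times)
    (w : Vertex R) : D.hE v w = 0 := by
  rw [hE, Matrix.sum_apply]
  refine Finset.sum_eq_zero fun e he => ?_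
  have : v.node ∉ e := fun h => hv (D.mem_times_of_mem_E e he _ h)
  simp [nodeOperator_apply, this]

variable {D g}

/-- Kernel vectors of `A(G) - e₁` restrict to the span of the states `|ψ_{z,a}⟩` on each diagram
element. -/
lemma mem_psiSpan_of_mulVec_eq_zero (hg : HasG0Spectrum g) {k : Vertex R → ℂ}
    (hk : (D.adj g - (e1 : ℂ) • 1) *ᵥ k = 0) (q : Fin R) :
    (fun v => k (q, v)) ∈ psiSpan := by
  set B : Matrix Vertex0 Vertex0 ℂ := g.adjMatrix ℂ - (e1 : ℂ) • 1 with hB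
  have hsplit : D.adj g - (e1 : ℂ) • 1 =
      (1 : Matrix (Fin R) (Fin R) ℂ) ⊗ₖ B + (D.hS + D.hE) := by
    have : (1 : Matrix (Fin R) (Fin R) ℂ) ⊗ₖ B =
        (1 : Matrix (Fin R) (Fin R) ℂ) ⊗ₖ g.adjMatrix ℂ - (e1 : ℂ) • 1 := by
      rw [hB, sub_eq_add_neg, ← neg_smul, kronecker_add, kronecker_smul, one_kronecker_one,
        neg_smul, ← sub_eq_add_neg]
    rw [this, adj]
    abel
  have hBpos : B.PosSemidef :=
    posSemidef_sub_of_isLeast (isHermitian_adjMatrix g) hg.isLeast_e1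
  rw [hsplit] at hk
  have hk' := mulVec_eq_zero_of_posSemidef_add (PosSemidef.one.kronecker hBpos)
    (D.posSemidef_hS.add D.posSemidef_hE) hk
  rw [psiSpan, ← hg.eigenspace_e1, Module.End.mem_eigenspace_iff, toLin'_apply, ← sub_eq_zero]
  ext v
  have := congrFun hk' (q, v)
  rw [one_kronecker_mulVec, hB, sub_mulVec, smul_mulVec, one_mulVec] at this
  exact this

open Classical in
-- On each element one unused t carries exactly one eighth of the weight, and all of its vertices
-- lie in 𝒩.
lemma sum_normSq_le_of_mem_psiSpan {k : Vertex R → ℂ}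
    (hk : ∀ q, (fun v => k (q, v)) ∈ psiSpan) :
    ∑ v, Complex.normSq (k v) ≤
      8 * ∑ v, if v ∈ D.noLoop then Complex.normSq (k v) else 0 := by
  rw [Fintype.sum_prod_type, Fintype.sum_prod_type, Finset.mul_sum]
  refine Finset.sum_le_sum fun q _ => ?_
  set u := (D.label q).unusedTime with hu
  have hmem : ∀ z j, ((q, z, u, j) : Vertex R) ∈ D.noLoop := fun z j =>
    mem_noLoop_of_notMem_times (ElementLabel.unusedTime_notMem _)
  have hall : ∑ v : Vertex0, Complex.normSq (k (q, v)) =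
      8 * ∑ z, ∑ j, Complex.normSq (k (q, z, u, j)) := by
    simp only [Fintype.sum_prod_type]
    rw [Finset.sum_comm, Finset.sum_congr rfl fun t _ => sum_normSq_of_mem_psiSpan (hk q) t u]
    simp [mul_add]
  rw [hall]
  refine mul_le_mul_of_nonneg_left ?_ (by norm_num)
  simp only [Fintype.sum_prod_type]
  refine Finset.sum_le_sum fun z _ => ?_
  refine le_trans (le_of_eq ?_) (Finset.single_le_sum
    (f := fun t => ∑ j, if ((q, z, t, j) : Vertex R) ∈ D.noLoop then
      Complex.normSq (k (q, z, t, j)) else 0)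
    (fun t _ => Finset.sum_nonneg fun j _ => ?_) (Finset.mem_univ u))
  · simp [hmem]
  · split_ifs <;> simp [Complex.normSq_nonneg]

lemma sub_apply_of_notMem_times {v : Vertex R} (hv : v.2.2.1 ∉ (D.label v.1).times)
    (w : Vertex R) : (D.adj g - (e1 : ℂ) • 1) v w =
      (1 : Matrix (Fin R) (Fin R) ℂ) v.1 w.1 * g.adjMatrix ℂ v.2 w.2 -
        (e1 : ℂ) * (1 : Matrix (Vertex R) (Vertex R) ℂ) v w := by
  simp [adj, hS_apply_of_notMem_times hv, hE_apply_of_notMem_times hv, kroneckerMap_apply]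

/-- A variational bound: a vector orthogonal to the kernel has Rayleigh quotient at least γ. The
test vector gives 1 - e₁ = 2 + 3√2 ≤ 7. -/
lemma le_seven_of_mem_lowerBounds (hg : HasG0Spectrum g) {γ : ℝ}
    (hγ : γ ∈ lowerBounds (eigenvalueSet (D.adj g - (e1 : ℂ) • 1) \ {0}))
    (hM : (D.adj g - (e1 : ℂ) • 1).IsHermitian) (q : Fin R) : γ ≤ 7 := by
  set u := (D.label q).unusedTime with hu
  have hun : u ∉ (D.label q).times := ElementLabel.unusedTime_notMem _
  set v : Vertex R := (q, 0, u, 0) with hv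
  set w : Vertex R := (q, 0, u, 4) with hw
  have hvw : v ≠ w := by simp [hv, hw]
  -- Both vertices sit at an unused t, so neither `hS` nor `hE` contributes; j = 0 and j = 4 make
  -- `x` orthogonal to every kernel vector.
  set x : Vertex R → ℂ := Pi.single v 1 + Pi.single w 1 with hx
  have hxstar : star x = x := by
    ext i
    simp only [hx, Pi.star_apply, Pi.add_apply, Pi.single_apply]
    split_ifs <;> simp
  have hxdot : ∀ y : Vertex R → ℂ, x ⬝ᵥ y = y v + y w := fun y => by simp [hx, add_dotProduct]
  obtain ⟨k, y, hxky, hk, hky, hquad⟩ := exists_kernel_decomposition hM hγ x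
  have hk0 : k = 0 := by
    apply eq_zero_of_re_star_dotProduct_self
    have h1 : star k ⬝ᵥ x = 0 := by
      rw [star_dotProduct, hxstar, hxdot, hv, hw,
        add_eq_zero_of_mem_psiSpan (mem_psiSpan_of_mulVec_eq_zero hg hk q), star_zero]
    rw [hxky, dotProduct_add, hky, add_zero] at h1
    rw [h1, Complex.zero_re]
  have hyx : y = x := by rw [hxky, hk0, zero_add]
  have hxx : (star x ⬝ᵥ x).re = 2 := by
    rw [hxstar, hxdot]
    simp [hx, hvw, hvw.symm]
    norm_num
  have hMx : (star x ⬝ᵥ (D.adj g - (e1 : ℂ) • 1) *ᵥ x).re ≤ 2 - 2 * e1 := by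
    rw [hxstar, hxdot]
    have hmul : ∀ i, ((D.adj g - (e1 : ℂ) • 1) *ᵥ x) i =
        (D.adj g - (e1 : ℂ) • 1) i v + (D.adj g - (e1 : ℂ) • 1) i w := fun i => by
      simp only [hx, mulVec_add, mulVec_single_one, Pi.add_apply, col_apply]
    rw [hmul, hmul, sub_apply_of_notMem_times hun, sub_apply_of_notMem_times hun,
      sub_apply_of_notMem_times hun, sub_apply_of_notMem_times hun]
    simp only [one_apply_eq, one_apply_ne hvw, one_apply_ne hvw.symm,
      show (1 : Matrix (Fin R) (Fin R) ℂ) v.1 w.1 = 1 from one_apply_eq q,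
      show (1 : Matrix (Fin R) (Fin R) ℂ) w.1 v.1 = 1 from one_apply_eq q]
    simp only [SimpleGraph.adjMatrix_apply, SimpleGraph.irrefl, if_false]
    split_ifs <;> simp <;> linarith
  have hsqrt : √2 ≤ 5 / 3 := Real.sqrt_le_iff.2 (by norm_num)
  rw [hyx, hxx] at hquad
  have : e1 = -1 - 3 * √2 := rfl
  linarith

lemma IsE1GateGraph.nonempty (hD : D.IsE1GateGraph g) : Nonempty (Fin R) := by
  obtain ⟨x, hx, -⟩ := mem_eigenvalueSet_iff.1 hD.1
  obtain ⟨v, -⟩ := Function.ne_iff.1 hx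
  exact ⟨v.1⟩

/-- The diagonal entry at a vertex of unused t is -e₁ ≠ 0, so the Hermitian matrix A(G) - e₁ is not
zero. -/
lemma IsE1GateGraph.exists_isSmallestNonzeroEigenvalue (hD : D.IsE1GateGraph g) :
    ∃ γ, IsSmallestNonzeroEigenvalue (D.adj g - (e1 : ℂ) • 1) γ := by
  have hM := (posSemidef_sub_of_isLeast (D.isHermitian_adj g) hD).1
  obtain ⟨q⟩ := hD.nonempty
  have he : e1 ≠ 0 := by
    have := Real.sqrt_nonneg 2
    unfold e1
    linarith
  have hne : hM.eigenvalues ≠ 0 := fun h => he <| by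
    have h0 := hM.eigenvalues_eq_zero_iff.1 h
    have := congrFun (congrFun h0 (q, 0, (D.label q).unusedTime, 0))
      (q, 0, (D.label q).unusedTime, 0)
    rw [sub_apply_of_notMem_times (ElementLabel.unusedTime_notMem _)] at this
    simpa [SimpleGraph.adjMatrix_apply] using this
  obtain ⟨i, hi⟩ := Function.ne_iff.1 hne
  exact GateGraph.exists_isSmallestNonzeroEigenvalue (eigenvalues_mem_eigenvalueSet hM i) hi

/-- The action of `A(G^SL)` on the symmetric and antisymmetric parts. -/
lemma adjSL_mulVec (X : Vertex R × Fin 2 → ℂ) (v : Vertex R) (d : Fin 2) :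
    (D.adjSL g *ᵥ X) (v, d) = (D.adj g *ᵥ fun w => X (w, d)) v +
      (D.projNoLoop *ᵥ fun w => X (w, 0) + X (w, 1)) v := by
  have h1 : ∀ (A : Matrix (Vertex R) (Vertex R) ℂ) (B : Matrix (Fin 2) (Fin 2) ℂ),
      ((A ⊗ₖ B) *ᵥ X) (v, d) = (A *ᵥ fun w => ∑ d', B d d' * X (w, d')) v := by
    intro A B
    simp only [mulVec, dotProduct, kroneckerMap_apply, Finset.mul_sum, mul_assoc]
    rw [Fintype.sum_prod_type]
  rw [adjSL, add_mulVec, smul_mulVec, Pi.add_apply, Pi.smul_apply, h1, h1]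
  congr 1
  · simp [one_apply]
  · rw [← Pi.smul_apply, ← mulVec_smul]
    congr 2
    ext w
    fin_cases d <;> simp [Fin.sum_univ_two] <;> ring

/-- The antisymmetric vector (x, -x) is annihilated by Π_+. -/
lemma mem_eigenvalueSet_adjSL {μ : ℝ} (h : μ ∈ eigenvalueSet (D.adj g)) :
    μ ∈ eigenvalueSet (D.adjSL g) := by
  obtain ⟨x, hx, hμ⟩ := mem_eigenvalueSet_iff.1 h
  refine mem_eigenvalueSet_iff.2 ⟨fun p => if p.2 = 0 then x p.1 else -x p.1, ?_, ?_⟩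
  · obtain ⟨v, hv⟩ := Function.ne_iff.1 hx
    exact Function.ne_iff.2 ⟨(v, 0), by simpa using hv⟩
  · ext ⟨v, d⟩
    rw [adjSL_mulVec]
    have h0 : (D.projNoLoop *ᵥ fun w => x w + -x w) v = 0 := by
      simp only [add_neg_cancel]
      exact congrFun (mulVec_zero _) v
    have hv : (D.adj g *ᵥ x) v = (μ : ℂ) * x v := by rw [hμ]; rfl
    fin_cases d
    · change (D.adj g *ᵥ x) v + (D.projNoLoop *ᵥ fun w => x w + -x w) v = (μ : ℂ) * x v
      rw [h0, hv, add_zero]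
    · change (D.adj g *ᵥ (-x)) v + (D.projNoLoop *ᵥ fun w => x w + -x w) v = (μ : ℂ) * -x v
      rw [h0, mulVec_neg, Pi.neg_apply, hv, mul_neg, add_zero]

/-- Each eigenvalue of `A(G^SL)` is an eigenvalue of `A(G)` or of `A(G) + 2 Π_𝒩`. -/
lemma eigenvalue_adjSL {μ : ℝ} (h : μ ∈ eigenvalueSet (D.adjSL g)) :
    μ ∈ eigenvalueSet (D.adj g) ∨ μ ∈ eigenvalueSet (D.adj g + (2 : ℂ) • D.projNoLoop) := by
  obtain ⟨X, hX, hμ⟩ := mem_eigenvalueSet_iff.1 h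
  have hX' : ∀ v d, (D.adj g *ᵥ fun w => X (w, d)) v +
      (D.projNoLoop *ᵥ fun w => X (w, 0) + X (w, 1)) v = μ * X (v, d) := fun v d => by
    rw [← adjSL_mulVec, hμ]; rfl
  -- A nonzero antisymmetric part is itself an eigenvector of A(G). If it vanishes, the symmetric
  -- part is nonzero and sees the full 2Π, since Π_+ acts on it as the identity.
  by_cases hm : (fun w => X (w, 0)) - (fun w => X (w, 1)) = 0
  · refine Or.inr (mem_eigenvalueSet_iff.2
      ⟨(fun w => X (w, 0)) + (fun w => X (w, 1)), fun hp => hX ?_, ?_⟩)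
    · ext ⟨v, d⟩
      have h1 := congrFun hm v
      have h2 := congrFun hp v
      simp only [Pi.sub_apply, Pi.add_apply, Pi.zero_apply] at h1 h2
      fin_cases d
      · change X (v, 0) = 0
        linear_combination (h1 + h2) / 2
      · change X (v, 1) = 0
        linear_combination (h2 - h1) / 2
    · ext v
      rw [add_mulVec, mulVec_add, smul_mulVec]
      change (D.adj g *ᵥ fun w => X (w, 0)) v + (D.adj g *ᵥ fun w => X (w, 1)) v +
        2 * (D.projNoLoop *ᵥ fun w => X (w, 0) + X (w, 1)) v = μ * (X (v, 0) + X (v, 1))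
      linear_combination hX' v 0 + hX' v 1
  · refine Or.inl (mem_eigenvalueSet_iff.2 ⟨_, hm, ?_⟩)
    ext v
    rw [mulVec_sub]
    change (D.adj g *ᵥ fun w => X (w, 0)) v - (D.adj g *ᵥ fun w => X (w, 1)) v =
      μ * (X (v, 0) - X (v, 1))
    linear_combination hX' v 0 - hX' v 1

theorem smallestNonzeroEigenvalue_adjSL_ge (hg : HasG0Spectrum g) (hD : D.IsE1GateGraph g) :
    ∃ γ γSL : ℝ, IsSmallestNonzeroEigenvalue (D.adj g - (e1 : ℂ) • 1) γ ∧
      IsSmallestNonzeroEigenvalue (D.adjSL g - (e1 : ℂ) • 1) γSL ∧ 1 / 56 * γ ≤ γSL := by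
  classical
  have hM := posSemidef_sub_of_isLeast (D.isHermitian_adj g) hD
  obtain ⟨q⟩ := hD.nonempty
  obtain ⟨γ, hγ⟩ := hD.exists_isSmallestNonzeroEigenvalue
  obtain ⟨γSL, hγSL⟩ := GateGraph.exists_isSmallestNonzeroEigenvalue
    (mem_eigenvalueSet_sub_iff.2 (mem_eigenvalueSet_adjSL (mem_eigenvalueSet_sub_iff.1 hγ.1.1)))
    hγ.1.2
  refine ⟨γ, γSL, hγ, hγSL, ?_⟩
  rcases eigenvalue_adjSL (mem_eigenvalueSet_sub_iff.1 hγSL.1.1) with h | h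
  · have h1 : γ ≤ γSL := hγ.2 ⟨mem_eigenvalueSet_sub_iff.2 h, hγSL.1.2⟩
    have h0 : 0 ≤ γ := by
      have := hD.2 (mem_eigenvalueSet_sub_iff.1 hγ.1.1)
      linarith
    linarith
  · obtain ⟨x, hx, hμ⟩ := mem_eigenvalueSet_iff.1 (mem_eigenvalueSet_sub_iff.2 h)
    rw [add_sub_right_comm] at hμ
    refine eigenvalue_add_projection_ge hM hγ.2 (le_seven_of_mem_lowerBounds hg hγ.2 hM.1 q)
      (fun v => v ∈ D.noLoop) (fun k hk => ?_) hx (μ := γSL) ?_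
    · exact sum_normSq_le_of_mem_psiSpan (mem_psiSpan_of_mulVec_eq_zero hg hk)
    · rw [← hμ, projNoLoop]

end GateDiagram

/-! ### The spectrum of `g₀` -/

lemma g0_adj_iff (z z' : Fin 2) (t t' j j' : Fin 8) :
    g0.Adj (z, t, j) (z', t', j') ↔
      (t' = t - 1 ∧ j' = j - hopExponent (t - 1) z z') ∨
      (t' = t + 1 ∧ j' = j + hopExponent t z' z) ∨
      (z' = z ∧ t' = t ∧ (j' = j + 3 ∨ j' = j + 4 ∨ j' = j + 5)) := by
  have h1 : t = t' + 1 ↔ t' = t - 1 := by rw [eq_sub_iff_add_eq, eq_comm]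
  -- Modulo 8, -3 = 5 and -4 = 4: symmetrizing the shifts 3 and 4 produces the shifts 3, 4, 5.
  have h3 : j = j' + 3 ↔ j' = j + 5 := by omega
  have h4 : j = j' + 4 ↔ j' = j + 4 := by omega
  have hj : ∀ k, j = j' + k ↔ j' = j - k := fun k => by rw [eq_sub_iff_add_eq, eq_comm]
  have hne : ∀ s : Fin 8, s ≠ s + 1 ∧ s ≠ s - 1 ∧ s ≠ s + 3 ∧ s ≠ s + 4 ∧ s ≠ s + 5 := by decide
  simp only [g0, SimpleGraph.fromRel_adj, h1, h3, h4, hj, ne_eq, Prod.mk.injEq]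
  constructor
  · rintro ⟨-, (h | ⟨h, h', h''⟩) | ⟨rfl, h⟩ | ⟨h, h', h''⟩⟩
    · exact Or.inr (Or.inl h)
    · exact Or.inr (Or.inr ⟨h, h', by tauto⟩)
    · exact Or.inl ⟨rfl, h⟩
    · exact Or.inr (Or.inr ⟨h.symm, h'.symm, by tauto⟩)
  · rintro (⟨rfl, h⟩ | ⟨rfl, h⟩ | ⟨rfl, rfl, h⟩)
    · exact ⟨fun h' => (hne t).2.1 h'.2.1, Or.inr (Or.inl ⟨rfl, h⟩)⟩
    · exact ⟨fun h' => (hne t).1 h'.2.1, Or.inl (Or.inl ⟨rfl, h⟩)⟩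
    · obtain ⟨-, -, hj3, hj4, hj5⟩ := hne j
      rcases h with rfl | rfl | rfl
      · exact ⟨fun h => hj3 h.2.2, Or.inl (Or.inr ⟨rfl, rfl, Or.inl rfl⟩)⟩
      · exact ⟨fun h => hj4 h.2.2, Or.inl (Or.inr ⟨rfl, rfl, Or.inr rfl⟩)⟩
      · exact ⟨fun h => hj5 h.2.2, Or.inr (Or.inr ⟨rfl, rfl, Or.inl rfl⟩)⟩

/-- The disjunction defining adjacency becomes a sum because its alternatives exclude one another: t
- 1, t, t + 1 are distinct modulo 8, as are the shifts 3, 4, 5. -/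
lemma g0_adjMatrix_apply (z z' : Fin 2) (t t' j j' : Fin 8) :
    g0.adjMatrix ℂ (z, t, j) (z', t', j') =
      (if t' = t - 1 then if j' = j - hopExponent (t - 1) z z' then 1 else 0 else 0) +
      (if t' = t + 1 then if j' = j + hopExponent t z' z then 1 else 0 else 0) +
      (if z' = z then if t' = t then (if j' = j + 3 then 1 else 0) +
        (if j' = j + 4 then 1 else 0) + (if j' = j + 5 then 1 else 0) else 0 else 0) := by
  have hne : ∀ s : Fin 8, s ≠ s + 1 ∧ s ≠ s - 1 ∧ s - 1 ≠ s + 1 ∧ s + 1 ≠ s - 1 ∧ s - 1 ≠ s ∧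
    s + 1 ≠ s := by decide
  obtain ⟨h1, h2, h3, h4, h5, h6⟩ := hne t
  rw [SimpleGraph.adjMatrix_apply]
  simp only [g0_adj_iff]
  by_cases ha : t' = t - 1
  · subst ha; simp [h3, h5]
  by_cases hb : t' = t + 1
  · subst hb; simp [h4, h6]
  by_cases hc : z' = z ∧ t' = t
  · obtain ⟨rfl, rfl⟩ := hc
    simp only [h1, h2, false_and, false_or, if_false, true_and, if_true, zero_add]
    by_cases hj3 : j' = j + 3
    · subst hj3; simp
    by_cases hj4 : j' = j + 4
    · subst hj4; simp
    simp [hj3, hj4]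
  · have : ¬ (z' = z ∧ t' = t ∧ (j' = j + 3 ∨ j' = j + 4 ∨ j' = j + 5)) := by tauto
    simp only [ha, hb, this, false_and, false_or, if_false, zero_add]
    split_ifs <;> tauto

lemma g0_mulVec (x : Vertex0 → ℂ) (z : Fin 2) (t j : Fin 8) :
    (g0.adjMatrix ℂ *ᵥ x) (z, t, j) =
      ∑ z', x (z', t - 1, j - hopExponent (t - 1) z z') +
      ∑ z', x (z', t + 1, j + hopExponent t z' z) +
      (x (z, t, j + 3) + x (z, t, j + 4) + x (z, t, j + 5)) := by
  simp only [mulVec, dotProduct, Fintype.sum_prod_type, g0_adjMatrix_apply, add_mul, ite_mul,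
    one_mul, zero_mul, Finset.sum_add_distrib]
  simp only [Finset.sum_ite_irrel, Finset.sum_const_zero, Finset.sum_ite_eq', Finset.mem_univ,
    if_true, Finset.sum_add_distrib]

/-! #### Characters of the cyclic group of order eight -/

/-- The character `k ↦ e^{iπk/4}`. -/
noncomputable def zetaChar (k : Fin 8) : ℂ := zeta ^ (k : ℕ)

lemma isPrimitiveRoot_zeta : IsPrimitiveRoot zeta 8 := by
  have := Complex.isPrimitiveRoot_exp 8 (by norm_num)
  convert this using 1
  rw [zeta]
  congr 1
  push_cast
  ring

lemma zetaChar_zero : zetaChar 0 = 1 := by simp [zetaChar]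

lemma zetaChar_add (a b : Fin 8) : zetaChar (a + b) = zetaChar a * zetaChar b := by
  rw [zetaChar, zetaChar, zetaChar, ← pow_add, Fin.val_add]
  exact (pow_eq_pow_mod _ isPrimitiveRoot_zeta.pow_eq_one).symm

lemma norm_zetaChar (a : Fin 8) : ‖zetaChar a‖ = 1 := by
  rw [zetaChar, norm_pow, isPrimitiveRoot_zeta.norm'_eq_one (by norm_num), one_pow]

lemma zetaChar_neg (a : Fin 8) : zetaChar (-a) = conj (zetaChar a) := by
  have h : zetaChar a * zetaChar (-a) = 1 := by
    rw [← zetaChar_add, add_neg_cancel, zetaChar_zero]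
  have h' : conj (zetaChar a) * zetaChar a = 1 := by
    rw [← Complex.normSq_eq_conj_mul_self, Complex.normSq_eq_norm_sq, norm_zetaChar]; simp
  linear_combination conj (zetaChar a) * h - zetaChar (-a) * h'

lemma zetaChar_one : zetaChar 1 = zeta := by simp [zetaChar]

lemma zetaChar_two : zetaChar 2 = Complex.I := by simp [zetaChar, zeta_sq]

lemma zetaChar_four : zetaChar 4 = -1 := by simp [zetaChar, zeta_pow_four]

lemma zetaChar_three : zetaChar 3 = -conj zeta := by simp [zetaChar, conj_zeta]

lemma zetaChar_five : zetaChar 5 = -zeta := by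
  rw [show (5 : Fin 8) = 4 + 1 from rfl, zetaChar_add, zetaChar_four, zetaChar_one]; ring

lemma zetaChar_six : zetaChar 6 = -Complex.I := by
  rw [show (6 : Fin 8) = 4 + 2 from rfl, zetaChar_add, zetaChar_four, zetaChar_two]; ring

lemma zetaChar_seven : zetaChar 7 = conj zeta := by
  rw [show (7 : Fin 8) = 4 + 3 from rfl, zetaChar_add, zetaChar_four, zetaChar_three]; ring

lemma fin_eight_mul_add (m a b : Fin 8) : m * (a + b) = m * a + m * b := by
  revert m a b; decide

lemma fin_eight_mul_neg (m a : Fin 8) : m * -a = -(m * a) := by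
  revert m a; decide

lemma sum_zetaChar_mul {k : Fin 8} (hk : k ≠ 0) : ∑ m, zetaChar (m * k) = 0 := by
  fin_cases k
  · exact absurd rfl hk
  all_goals
    simp only [Fin.sum_univ_eight]
    simp [Fin.reduceMul, Fin.mk_one, zetaChar_zero, zetaChar_one, zetaChar_two,
      zetaChar_three, zetaChar_four, zetaChar_five, zetaChar_six, zetaChar_seven]
    try ring

/-- The component of `x` of character `m` in the third register. -/
noncomputable def fourier (m : Fin 8) (x : Vertex0 → ℂ) (z : Fin 2) (t : Fin 8) : ℂ :=
  ∑ j, zetaChar (m * j) * x (z, t, j)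

lemma sum_zetaChar_shift (m k : Fin 8) (f : Fin 8 → ℂ) :
    ∑ j, zetaChar (m * j) * f (j + k) = zetaChar (-(m * k)) * ∑ j, zetaChar (m * j) * f j := by
  rw [← Equiv.sum_comp (Equiv.addRight k) (fun j => zetaChar (m * j) * f j), Finset.mul_sum]
  refine Finset.sum_congr rfl fun j _ => ?_
  rw [← mul_assoc, ← zetaChar_add, Equiv.coe_addRight, fin_eight_mul_add, neg_add_eq_sub,
    add_sub_cancel_right]

lemma fourier_inversion (x : Vertex0 → ℂ) (z : Fin 2) (t j : Fin 8) :
    ∑ m, zetaChar (m * -j) * fourier m x z t = 8 * x (z, t, j) := by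
  simp only [fourier, Finset.mul_sum]
  rw [Finset.sum_comm]
  have : ∀ i, ∑ m, zetaChar (m * -j) * (zetaChar (m * i) * x (z, t, i)) =
      if i = j then 8 * x (z, t, j) else 0 := by
    intro i
    have h1 : ∀ m, zetaChar (m * -j) * (zetaChar (m * i) * x (z, t, i)) =
        zetaChar (m * (i - j)) * x (z, t, i) := fun m => by
      rw [← mul_assoc, ← zetaChar_add, ← fin_eight_mul_add, neg_add_eq_sub]
    simp only [h1, ← Finset.sum_mul]
    split_ifs with h
    · subst h; simp [zetaChar_zero]
    · rw [sum_zetaChar_mul (sub_ne_zero.2 h), zero_mul]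
  simp only [this, Finset.sum_ite_eq', Finset.mem_univ, if_true]

/-! ### Eigenvectors of g₀, character by character -/

lemma fourier_eigenvector {x : Vertex0 → ℂ} {μ : ℝ} (hx : g0.adjMatrix ℂ *ᵥ x = (μ : ℂ) • x)
    (m : Fin 8) (z : Fin 2) (t : Fin 8) :
    (μ : ℂ) * fourier m x z t =
      ∑ z', zetaChar (m * hopExponent (t - 1) z z') * fourier m x z' (t - 1) +
      ∑ z', conj (zetaChar (m * hopExponent t z' z)) * fourier m x z' (t + 1) +
      (zetaChar (m * 3) + zetaChar (m * 4) + zetaChar (m * 5)) * fourier m x z t := by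
  have h : ∀ j, (μ : ℂ) * x (z, t, j) = _ := fun j =>
    (congrFun hx (z, t, j)).symm.trans (g0_mulVec x z t j)
  have hs : ∀ z' t' k, ∑ j, zetaChar (m * j) * x (z', t', j + k) =
      zetaChar (-(m * k)) * fourier m x z' t' :=
    fun z' t' k => sum_zetaChar_shift m k fun j => x (z', t', j)
  have hs' : ∀ z' t' k, ∑ j, zetaChar (m * j) * x (z', t', j - k) =
      zetaChar (m * k) * fourier m x z' t' := fun z' t' k => by
    simp only [sub_eq_add_neg, hs, fin_eight_mul_neg, neg_neg]
  have hL : (μ : ℂ) * fourier m x z t = ∑ j, zetaChar (m * j) * (μ * x (z, t, j)) := by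
    rw [fourier, Finset.mul_sum]
    exact Finset.sum_congr rfl fun j _ => by ring
  rw [hL]
  simp only [h, mul_add, Finset.sum_add_distrib, Fin.sum_univ_two, hs, hs', ← zetaChar_neg]
  rw [← fin_eight_mul_neg m 3, ← fin_eight_mul_neg m 4, ← fin_eight_mul_neg m 5,
    show -3 = (5 : Fin 8) from rfl, show -4 = (4 : Fin 8) from rfl, show -5 = (3 : Fin 8) from rfl]
  ring

/-- Gershgorin's argument at an entry of largest modulus: the four hopping terms have unimodular
coefficients and the diagonal term `c` is at least -1, so a nonzero component would force μ ≥ -5,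
whereas e₁ < -5. -/
lemma fourier_eq_zero {x : Vertex0 → ℂ} {μ : ℝ} (hx : g0.adjMatrix ℂ *ᵥ x = (μ : ℂ) • x)
    (hμ : μ ≤ e1) {m : Fin 8} (h1 : m ≠ 1) (h7 : m ≠ 7) (z : Fin 2) (t : Fin 8) :
    fourier m x z t = 0 := by
  have hs2 : 0 < √2 := by positivity
  obtain ⟨c, hc, hc1⟩ : ∃ c : ℝ,
      zetaChar (m * 3) + zetaChar (m * 4) + zetaChar (m * 5) = c ∧ -1 ≤ c := by
    have hz := zeta_add_conj
    fin_cases m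
    · exact ⟨3, by simp [zetaChar_zero]; norm_num, by norm_num⟩
    · exact absurd rfl h1
    · exact ⟨1, by simp [zetaChar_zero, zetaChar_two, zetaChar_six], by norm_num⟩
    · refine ⟨-1 + √2, ?_, by linarith⟩
      simp [zetaChar_one, zetaChar_four, zetaChar_seven]
      linear_combination hz
    · exact ⟨-1, by simp [zetaChar_four, zetaChar_zero], by norm_num⟩
    · refine ⟨-1 + √2, ?_, by linarith⟩
      simp [zetaChar_one, zetaChar_four, zetaChar_seven]
      linear_combination hz
    · exact ⟨1, by simp [zetaChar_zero, zetaChar_two, zetaChar_six], by norm_num⟩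
    · exact absurd rfl h7
  obtain ⟨⟨z₀, t₀⟩, hmax⟩ := Finite.exists_max fun p : Fin 2 × Fin 8 => ‖fourier m x p.1 p.2‖
  have heq := fourier_eigenvector hx m z₀ t₀
  rw [hc] at heq
  have heq' := sub_eq_of_eq_add heq
  rw [← sub_mul, ← Complex.ofReal_sub] at heq'
  have hb1 : ∀ a z t, ‖zetaChar a * fourier m x z t‖ ≤ ‖fourier m x z₀ t₀‖ := fun a z t => by
    rw [norm_mul, norm_zetaChar, one_mul]; exact hmax (z, t)
  have hle : |μ - c| * ‖fourier m x z₀ t₀‖ ≤ 4 * ‖fourier m x z₀ t₀‖ := by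
    rw [← Real.norm_eq_abs, ← Complex.norm_real, ← norm_mul, heq']
    simp only [← zetaChar_neg, Fin.sum_univ_two]
    refine (norm_add_le _ _).trans ?_
    have := add_le_add
      ((norm_add_le _ _).trans (add_le_add (hb1 (m * hopExponent (t₀ - 1) z₀ 0) 0 (t₀ - 1))
        (hb1 (m * hopExponent (t₀ - 1) z₀ 1) 1 (t₀ - 1))))
      ((norm_add_le _ _).trans (add_le_add (hb1 (-(m * hopExponent t₀ 0 z₀)) 0 (t₀ + 1))
        (hb1 (-(m * hopExponent t₀ 1 z₀)) 1 (t₀ + 1))))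
    linarith
  have habs : 4 < |μ - c| := by
    have h43 : 4 / 3 < √2 := Real.lt_sqrt_of_sq_lt (by norm_num)
    have he : e1 = -1 - 3 * √2 := rfl
    rw [lt_abs]
    right
    linarith
  have h0 : ‖fourier m x z₀ t₀‖ = 0 := by
    have := norm_nonneg (fourier m x z₀ t₀)
    nlinarith
  exact norm_le_zero_iff.1 ((hmax (z, t)).trans h0.le)

lemma stepUnitary_mul_conjTranspose (t : Fin 8) : stepUnitary t * (stepUnitary t)ᴴ = 1 :=
  mul_eq_one_comm.1 (stepUnitary_mul_self t)

/-- Each U_t factors as V_{t+1} V_t† with V_t = `stepUnitary t`, including the step from 8 back to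
1. The product around the cycle is therefore trivial, and the gates can be gauged away. -/
lemma zetaChar_hopExponent (t : Fin 8) (x z : Fin 2) :
    zetaChar (hopExponent t x z) =
      -((√2 : ℝ) : ℂ) * (stepUnitary (t + 1) * (stepUnitary t)ᴴ) x z := by
  have hr : ((√2 : ℝ) : ℂ) * ((1 / √2 : ℝ) : ℂ) = 1 := by
    rw [← Complex.ofReal_mul, mul_one_div_cancel (by positivity), Complex.ofReal_one]
  have hH : ∀ x z, ((√2 : ℝ) : ℂ) * gateH x z = !![1, 1; 1, -1] x z := fun x z => by
    rw [gateH, Matrix.smul_apply, smul_eq_mul, ← mul_assoc, hr, one_mul]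
  have hH' : ∀ x z, ((√2 : ℝ) : ℂ) * gateHᴴ x z = !![1, 1; 1, -1] x z := fun x z => by
    have := congrArg conj (hH z x)
    rw [map_mul, Complex.conj_ofReal] at this
    rw [conjTranspose_apply, ← starRingEnd_apply, this]
    fin_cases x <;> fin_cases z <;> simp
  have hHT : ∀ x z, ((√2 : ℝ) : ℂ) * (gateH * gateT) x z = !![1, zeta; 1, -zeta] x z :=
    fun x z => by
      have h0 := hH x 0
      have h1 := hH x 1
      rw [mul_apply, Fin.sum_univ_two, mul_add, ← mul_assoc, ← mul_assoc, h0, h1]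
      fin_cases x <;> fin_cases z <;> simp [gateT, zeta]
  have hHT' : ∀ x z, ((√2 : ℝ) : ℂ) * (gateH * gateT)ᴴ x z =
      !![1, 1; conj zeta, -conj zeta] x z := fun x z => by
    have := congrArg conj (hHT z x)
    rw [map_mul, Complex.conj_ofReal] at this
    rw [conjTranspose_apply, ← starRingEnd_apply, this]
    fin_cases x <;> fin_cases z <;> simp
  rw [neg_mul]
  have hcases : ∀ t : Fin 8, (t = 1 ∨ t = 7) ∨ (t = 0 ∨ t = 2) ∨ (t = 3 ∨ t = 5) ∨
    (t = 4 ∨ t = 6) := by decide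
  rcases hcases t with h | h | h | h
  · have hV : stepUnitary (t + 1) * (stepUnitary t)ᴴ = gateH := by
      rcases h with rfl | rfl <;> simp [stepUnitary]
    rw [hV, hH]
    rcases h with rfl | rfl <;> fin_cases x <;> fin_cases z <;>
      simp [hopExponent, zetaChar_four, zetaChar_zero]
  · have hV : stepUnitary (t + 1) * (stepUnitary t)ᴴ = gateHᴴ := by
      rcases h with rfl | rfl <;> simp [stepUnitary]
    rw [hV, hH']
    rcases h with rfl | rfl <;> fin_cases x <;> fin_cases z <;>
      simp [hopExponent, zetaChar_four, zetaChar_zero]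
  · have hV : stepUnitary (t + 1) * (stepUnitary t)ᴴ = gateH * gateT := by
      rcases h with rfl | rfl <;> simp [stepUnitary]
    rw [hV, hHT]
    rcases h with rfl | rfl <;> fin_cases x <;> fin_cases z <;>
      simp [hopExponent, zetaChar_four, zetaChar_five, zetaChar_one]
  · have hV : stepUnitary (t + 1) * (stepUnitary t)ᴴ = (gateH * gateT)ᴴ := by
      rcases h with rfl | rfl <;> simp [stepUnitary]
    rw [hV, hHT']
    rcases h with rfl | rfl <;> fin_cases x <;> fin_cases z <;>
      simp [hopExponent, zetaChar_four, zetaChar_three, zetaChar_seven]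

/-- On the cycle of length eight, eigenvectors with eigenvalue at least two are constant, and the
eigenvalue is two unless they vanish. -/
lemma cycle_eigenvector {f : Fin 8 → ℂ} {ν : ℝ} (hν : 2 ≤ ν)
    (h : ∀ t, (ν : ℂ) * f t = f (t - 1) + f (t + 1)) :
    (∀ t, f t = f 0) ∧ (f 0 ≠ 0 → ν = 2) := by
  obtain ⟨t₀, hmax⟩ := Finite.exists_max fun t => ‖f t‖
  have hle : ν * ‖f t₀‖ ≤ 2 * ‖f t₀‖ := by
    have h1 : ‖(ν : ℂ) * f t₀‖ ≤ ‖f (t₀ - 1)‖ + ‖f (t₀ + 1)‖ := by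
      rw [h]; exact norm_add_le _ _
    rw [norm_mul, Complex.norm_real, Real.norm_of_nonneg (by linarith)] at h1
    linarith [hmax (t₀ - 1), hmax (t₀ + 1)]
  by_cases h0 : f t₀ = 0
  · have hz : ∀ t, f t = 0 := fun t => norm_le_zero_iff.1 ((hmax t).trans (by simp [h0]))
    simp [hz]
  · have hν2 : ν = 2 := le_antisymm (le_of_mul_le_mul_right hle (norm_pos_iff.2 h0)) hν
    refine ⟨?_, fun _ => hν2⟩
    subst hν2
    have e0 := h 0
    have e1 := h 1
    have e2 := h 2
    have e3 := h 3
    have e4 := h 4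
    have e5 := h 5
    have e6 := h 6
    have e7 := h 7
    simp only [Fin.reduceSub, Fin.reduceAdd, zero_sub, zero_add, sub_self,
      Complex.ofReal_ofNat] at e0 e1 e2 e3 e4 e5 e6 e7
    -- The weights 7, …, 1 on the vanishing second differences cancel all values except 8(f 0 - f
    -- 1), by periodicity.
    have hd : f 1 = f 0 := by
      linear_combination (7 * e1 + 6 * e2 + 5 * e3 + 4 * e4 + 3 * e5 + 2 * e6 + e7) / 8
    have h2 : f 2 = f 0 := by linear_combination 2 * hd - e1
    have h3 : f 3 = f 0 := by linear_combination 2 * h2 - hd - e2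
    have h4 : f 4 = f 0 := by linear_combination 2 * h3 - h2 - e3
    have h5 : f 5 = f 0 := by linear_combination 2 * h4 - h3 - e4
    have h6 : f 6 = f 0 := by linear_combination 2 * h5 - h4 - e5
    have h7 : f 7 = f 0 := by linear_combination 2 * h6 - h5 - e6
    intro t
    fin_cases t <;> first | rfl | assumption

/-- For `w t` = V_t† `y t` the hopping becomes that of the plain 8-cycle. The on-site term is ζ³ +
ζ⁴ + ζ⁵ = -1 - √2, so the cycle eigenvalue is -(μ + 1 + √2)/√2, and it is at least 2 exactly when μ
≤ e₁. -/
lemma fourier_one {x : Vertex0 → ℂ} {μ : ℝ} (hx : g0.adjMatrix ℂ *ᵥ x = (μ : ℂ) • x)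
    (hμ : μ ≤ e1) : ∃ a : Fin 2 → ℂ, (∀ z t, fourier 1 x z t = (stepUnitary t *ᵥ a) z) ∧
      (a ≠ 0 → μ = e1) := by
  set y : Fin 8 → Fin 2 → ℂ := fun t z => fourier 1 x z t with hy
  set w : Fin 8 → Fin 2 → ℂ := fun t => (stepUnitary t)ᴴ *ᵥ y t with hw
  have hs2 : 0 < √2 := by positivity
  have hs2c : ((√2 : ℝ) : ℂ) ≠ 0 := by exact_mod_cast hs2.ne'
  have hy' : ∀ t, ((μ + 1 + √2 : ℝ) : ℂ) • y t = (-((√2 : ℝ) : ℂ)) •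
      (stepUnitary t *ᵥ (w (t - 1) + w (t + 1))) := by
    intro t
    ext z
    have h := fourier_eigenvector hx 1 z t
    simp only [one_mul] at h
    have h1 : ∑ z', zetaChar (hopExponent (t - 1) z z') * fourier 1 x z' (t - 1) =
        -((√2 : ℝ) : ℂ) * (stepUnitary t *ᵥ w (t - 1)) z := by
      rw [hw, mulVec_mulVec]
      simp only [zetaChar_hopExponent, sub_add_cancel, mulVec, dotProduct, Finset.mul_sum,
        mul_assoc, hy]
    have h2 : ∑ z', conj (zetaChar (hopExponent t z' z)) * fourier 1 x z' (t + 1) =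
        -((√2 : ℝ) : ℂ) * (stepUnitary t *ᵥ w (t + 1)) z := by
      rw [hw, mulVec_mulVec]
      have h3 : stepUnitary t * (stepUnitary (t + 1))ᴴ =
          (stepUnitary (t + 1) * (stepUnitary t)ᴴ)ᴴ := by
        rw [conjTranspose_mul, conjTranspose_conjTranspose]
      rw [h3]
      simp only [zetaChar_hopExponent, mulVec, dotProduct, Finset.mul_sum, mul_assoc, hy,
        conjTranspose_apply, map_mul, map_neg, Complex.conj_ofReal]
      rfl
    rw [h1, h2, zetaChar_three, zetaChar_four, zetaChar_five] at h
    rw [mulVec_add]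
    simp only [Pi.smul_apply, Pi.add_apply, smul_eq_mul, hy]
    push_cast
    linear_combination h - fourier 1 x z t * zeta_add_conj
  have hw' : ∀ t, ((-(μ + 1 + √2) / √2 : ℝ) : ℂ) • w t = w (t - 1) + w (t + 1) := by
    intro t
    have h := congrArg (fun v => (stepUnitary t)ᴴ *ᵥ v) (hy' t)
    simp only [mulVec_smul, mulVec_mulVec, stepUnitary_mul_self, one_mulVec] at h
    change _ • w t = _ at h
    ext z
    have hz := congrFun h z
    simp only [Pi.smul_apply, smul_eq_mul] at hz ⊢
    push_cast at hz ⊢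
    field_simp
    linear_combination -hz
  have hν : 2 ≤ -(μ + 1 + √2) / √2 := by
    rw [le_div_iff₀ hs2]
    have : e1 = -1 - 3 * √2 := rfl
    linarith
  have hcyc := fun z => cycle_eigenvector (f := fun t => w t z) hν fun t => congrFun (hw' t) z
  refine ⟨w 0, fun z t => ?_, fun h => ?_⟩
  · have hwt : w t = w 0 := by ext z; exact (hcyc z).1 t
    rw [← hwt, hw, mulVec_mulVec, stepUnitary_mul_conjTranspose, one_mulVec]
  · obtain ⟨z, hz⟩ := Function.ne_iff.1 h
    have := (hcyc z).2 hz
    rw [div_eq_iff hs2.ne'] at this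
    unfold e1
    linarith

/-- The adjacency matrix and μ are real; this transfers results on character 1 to character 7. -/
lemma conj_eigenvector {x : Vertex0 → ℂ} {μ : ℝ} (hx : g0.adjMatrix ℂ *ᵥ x = (μ : ℂ) • x) :
    g0.adjMatrix ℂ *ᵥ (star x) = (μ : ℂ) • star x := by
  ext ⟨z, t, j⟩
  have h := congrArg conj (congrFun hx (z, t, j))
  rw [g0_mulVec] at h ⊢
  simpa using h

lemma fourier_seven (x : Vertex0 → ℂ) (z : Fin 2) (t : Fin 8) :
    fourier 7 x z t = conj (fourier 1 (star x) z t) := by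
  simp only [fourier, map_sum, map_mul, Pi.star_apply, ← zetaChar_neg, one_mul]
  refine Finset.sum_congr rfl fun j _ => ?_
  have : ∀ j : Fin 8, 7 * j = -j := by decide
  rw [this]
  simp

/-- Only characters 1 and 7 survive in the Fourier inversion. Allowing any μ ≤ e₁ gives minimality
of e₁ and the upper bound on its eigenspace together. -/
lemma mem_psiSpan_of_eigenvector {x : Vertex0 → ℂ} {μ : ℝ}
    (hx : g0.adjMatrix ℂ *ᵥ x = (μ : ℂ) • x) (hμ : μ ≤ e1) :
    x ∈ psiSpan ∧ (x ≠ 0 → μ = e1) := by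
  obtain ⟨a, ha, ha'⟩ := fourier_one hx hμ
  obtain ⟨b, hb, hb'⟩ := fourier_one (conj_eigenvector hx) hμ
  have hx' : ∀ z t j, 8 * x (z, t, j) = conj zeta ^ (j : ℕ) * (stepUnitary t *ᵥ a) z +
      zeta ^ (j : ℕ) * conj ((stepUnitary t *ᵥ b) z) := by
    intro z t j
    have h0 := fun {m : Fin 8} (h1 : m ≠ 1) (h7 : m ≠ 7) => fourier_eq_zero hx hμ h1 h7 z t
    have h7 : ∀ j : Fin 8, 7 * -j = j := by decide
    rw [← fourier_inversion, Fin.sum_univ_eight, h0 (m := 0) (by decide) (by decide),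
      h0 (m := 2) (by decide) (by decide), h0 (m := 3) (by decide) (by decide),
      h0 (m := 4) (by decide) (by decide), h0 (m := 5) (by decide) (by decide),
      h0 (m := 6) (by decide) (by decide), fourier_seven, ha, hb, one_mul, h7, zetaChar_neg,
      show zetaChar j = zeta ^ (j : ℕ) from rfl, map_pow]
    ring
  constructor
  · refine mem_psiSpan_iff.2 ⟨((1 / √8 : ℝ) : ℂ) • a, ((1 / √8 : ℝ) : ℂ) • b, fun z t j => ?_⟩
    rw [omegaState_eq, mulVec_smul, mulVec_smul]
    simp only [Pi.smul_apply, smul_eq_mul, map_mul, map_pow, Complex.conj_ofReal,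
      Complex.conj_conj]
    linear_combination (1 / 8) * hx' z t j -
      (conj zeta ^ (j : ℕ) * (stepUnitary t *ᵥ a) z +
        zeta ^ (j : ℕ) * conj ((stepUnitary t *ᵥ b) z)) * ofReal_inv_sqrt_eight_sq
  · intro hne
    by_contra hμ'
    have ha0 : a = 0 := by by_contra h; exact hμ' (ha' h)
    have hb0 : b = 0 := by by_contra h; exact hμ' (hb' h)
    refine hne (funext fun ⟨z, t, j⟩ => ?_)
    have := hx' z t j
    rw [ha0, hb0] at this
    simpa using this

/-! ### The ψ states as eigenvectors of g₀ -/

lemma omegaState_add (j k : Fin 8) : omegaState (j + k) = conj (zetaChar k) * omegaState j := by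
  have h : ∀ j, omegaState j = ((1 / √8 : ℝ) : ℂ) * conj (zetaChar j) := fun j => by
    rw [omegaState_eq, zetaChar, map_pow]
  rw [h, h, zetaChar_add, map_mul]
  ring

/-- On ω each S^k acts as the phase e^{iπk/4}. Hopping from either neighbour then contributes -√2,
and the on-site shifts contribute -1 - √2, for a total of e₁. -/
lemma eigenvector_stepUnitary_omegaState (a : Fin 2 → ℂ) :
    g0.adjMatrix ℂ *ᵥ (fun v => (stepUnitary v.2.1 *ᵥ a) v.1 * omegaState v.2.2) =
      (e1 : ℂ) • fun v => (stepUnitary v.2.1 *ᵥ a) v.1 * omegaState v.2.2 := by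
  ext ⟨z, t, j⟩
  rw [g0_mulVec]
  have hsub : ∀ k, omegaState (j - k) = zetaChar k * omegaState j := fun k => by
    rw [sub_eq_add_neg, omegaState_add, zetaChar_neg, Complex.conj_conj]
  have h1 : ∑ z', (stepUnitary (t - 1) *ᵥ a) z' * omegaState (j - hopExponent (t - 1) z z') =
      -((√2 : ℝ) : ℂ) * (stepUnitary t *ᵥ a) z * omegaState j := by
    have h : stepUnitary t *ᵥ a =
        (stepUnitary t * (stepUnitary (t - 1))ᴴ) *ᵥ (stepUnitary (t - 1) *ᵥ a) := by
      rw [mulVec_mulVec, Matrix.mul_assoc, stepUnitary_mul_self, Matrix.mul_one]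
    conv_rhs => rw [h, mulVec, dotProduct, Finset.mul_sum, Finset.sum_mul]
    refine Finset.sum_congr rfl fun z' _ => ?_
    rw [hsub, zetaChar_hopExponent, sub_add_cancel]
    ring
  have h2 : ∑ z', (stepUnitary (t + 1) *ᵥ a) z' * omegaState (j + hopExponent t z' z) =
      -((√2 : ℝ) : ℂ) * (stepUnitary t *ᵥ a) z * omegaState j := by
    have h : stepUnitary t *ᵥ a =
        (stepUnitary (t + 1) * (stepUnitary t)ᴴ)ᴴ *ᵥ (stepUnitary (t + 1) *ᵥ a) := by
      rw [conjTranspose_mul, conjTranspose_conjTranspose, mulVec_mulVec, Matrix.mul_assoc,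
        stepUnitary_mul_self, Matrix.mul_one]
    conv_rhs => rw [h, mulVec, dotProduct, Finset.mul_sum, Finset.sum_mul]
    refine Finset.sum_congr rfl fun z' _ => ?_
    rw [omegaState_add, zetaChar_hopExponent, conjTranspose_apply, map_mul, map_neg,
      Complex.conj_ofReal, ← starRingEnd_apply]
    ring
  simp only [Pi.smul_apply, smul_eq_mul]
  rw [h1, h2, omegaState_add, omegaState_add, omegaState_add, zetaChar_three, zetaChar_four,
    zetaChar_five, e1]
  simp only [map_neg, Complex.conj_conj, map_one]
  push_cast
  linear_combination -((stepUnitary t *ᵥ a) z * omegaState j) * zeta_add_conj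

lemma eigenvector_of_mem_psiSpan {x : Vertex0 → ℂ} (hx : x ∈ psiSpan) :
    g0.adjMatrix ℂ *ᵥ x = (e1 : ℂ) • x := by
  obtain ⟨a, b, h⟩ := mem_psiSpan_iff.1 hx
  have hsum : x = (fun v => (stepUnitary v.2.1 *ᵥ a) v.1 * omegaState v.2.2) +
      star fun v => (stepUnitary v.2.1 *ᵥ b) v.1 * omegaState v.2.2 := by
    ext ⟨z, t, j⟩
    rw [h]
    simp
  rw [hsum, mulVec_add, eigenvector_stepUnitary_omegaState,
    conj_eigenvector (eigenvector_stepUnitary_omegaState b), smul_add]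

theorem hasG0Spectrum_g0 : HasG0Spectrum g0 := by
  refine ⟨⟨?_, fun μ hμ => ?_⟩, ?_⟩
  · refine mem_eigenvalueSet_iff.2 ⟨psi 0 0, ?_,
      eigenvector_of_mem_psiSpan (Submodule.subset_span ⟨(0, 0), rfl⟩)⟩
    refine Function.ne_iff.2 ⟨(0, 1, 0), ?_⟩
    simp [psi, stepUnitary, omegaState]
  · obtain ⟨x, hx, hμx⟩ := mem_eigenvalueSet_iff.1 hμ
    rcases le_total e1 μ with h | h
    · exact h
    · exact ((mem_psiSpan_of_eigenvector hμx h).2 hx).ge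
  · ext x
    rw [Module.End.mem_eigenspace_iff, toLin'_apply]
    exact ⟨fun h => (mem_psiSpan_of_eigenvector h le_rfl).1, eigenvector_of_mem_psiSpan⟩

end GateGraph

theorem mainTheorem5 :
    GateGraph.HasG0Spectrum GateGraph.g0 ∧
    ∃ C : ℝ, 0 < C ∧
      ∀ (g : SimpleGraph GateGraph.Vertex0) [DecidableRel g.Adj], GateGraph.HasG0Spectrum g →
      ∀ (R : ℕ) (D : GateGraph.GateDiagram R), D.IsE1GateGraph g →
        ∃ γ γSL : ℝ,
          GateGraph.IsSmallestNonzeroEigenvalue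
            (D.adj g - (GateGraph.e1 : ℂ) • 1) γ ∧
          GateGraph.IsSmallestNonzeroEigenvalue
            (D.adjSL g - (GateGraph.e1 : ℂ) • 1) γSL ∧
          C * γ ≤ γSL := by
  refine ⟨GateGraph.hasG0Spectrum_g0, 1 / 56, by norm_num, ?_⟩
  intro g _ hg R D hD
  exact GateGraph.GateDiagram.smallestNonzeroEigenvalue_adjSL_ge hg hD
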